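/- Let $d,n\ge 0$ be integers and let $\mathcal M\subset\mathbb R^n$ be an embedded $d$-dimensional $C^1$ submanifold without boundary, with $\operatorname{reach}(\mathcal M)\ge\tau$ for some real $\tau>0$ and $d$-dimensional volume (the $d$-dimensional Hausdorff measure, normalized to agree with Lebesgue measure on $\mathbb R^d$) at most $V<\infty$. Here $\operatorname{reach}(\mathcal M)$ is the supremum of all $r$ such that every point of $\mathbb R^n$ at distance less than $r$ from $\mathcal M$ has a unique nearest point in $\mathcal M$. Let $\omega_d$ be the Lebesgue measure of the unit ball of $\mathbb R^d$. For $r>0$ let $N_C(r,\mathcal M)$ be the smallest number of Euclidean balls of $\mathbb R^n$ of radius at most $r$ whose union contains $\mathcal M$, and let $N_P(r,\mathcal M)$ be the largest number of mutually disjoint Euclidean balls of $\mathbb R^n$ of radius $r$ with centres in $\mathcal M$. Then for every $\varepsilon>0$: $$N_C(3\varepsilon,\mathcal M)\;\le\; N_P\!\left(\tfrac{3\varepsilon}{2},\mathcal M\right)\;\le\;\frac{V}{\omega_d\,\varepsilon^d}\qquad\text{if } \varepsilon\le\tau/4,$$ $$N_C(3\varepsilon,\mathcal M)\;\le\;\frac{V}{\omega_d\,(\tau/4)^d}\qquad\text{if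 } \varepsilon>\tau/4.$$ This holds both when all balls are taken to be open and when all balls are taken to be closed. -/

import Mathlib

open scoped NNReal ENNReal MeasureTheory

noncomputable section

/-- `M` is an embedded `d`-dimensional submanifold of `ℝⁿ` of class `C¹`, without boundary: around
each of its points some `C¹` diffeomorphism between open subsets of `ℝⁿ` straightens `M` to a
`d`-dimensional linear subspace. (`Φ.IsImage M L` says that, for `y` in the domain of `Φ`,
`Φ y ∈ L ↔ y ∈ M`.) -/
def IsC1Submanifold {n : ℕ} (d : ℕ) (M : Set (EuclideanSpace ℝ (Fin n))) : Prop :=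
  ∀ x ∈ M, ∃ (Φ : OpenPartialHomeomorph (EuclideanSpace ℝ (Fin n)) (EuclideanSpace ℝ (Fin n)))
      (L : Submodule ℝ (EuclideanSpace ℝ (Fin n))),
    x ∈ Φ.source ∧ ContDiffOn ℝ 1 Φ Φ.source ∧ ContDiffOn ℝ 1 Φ.symm Φ.target ∧
      Module.finrank ℝ L = d ∧ Φ.IsImage M (L : Set (EuclideanSpace ℝ (Fin n)))

/-- The reach of a set `S`: the supremum of all `r` such that every point at distance less than `r`
from `S` has a unique nearest point in `S`. -/
def reach {X : Type*} [MetricSpace X] (S : Set X) : ℝ≥0∞ :=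
  sSup {r : ℝ≥0∞ | ∀ x : X, Metric.infEDist x S < r →
    ∃! y : X, y ∈ S ∧ edist x y = Metric.infEDist x S}

/-- The smallest number of balls of radius at most `r` whose union contains `S`. A ball is recorded
as a pair (centre, radius). The parameter `B` says which balls are meant: it is `Metric.ball` for
open balls and `Metric.closedBall` for closed ones. -/
def coveringNum {X : Type*} (B : X → ℝ → Set X) (r : ℝ) (S : Set X) : ℕ∞ :=
  ⨅ (F : Set (X × ℝ)) (_ : ∀ p ∈ F, p.2 ≤ r) (_ : S ⊆ ⋃ p ∈ F, B p.1 p.2), F.encard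

/-- The largest number of mutually disjoint balls of radius `r` with centres in `S`
(with `B` as in `coveringNum`). -/
def packingNum {X : Type*} (B : X → ℝ → Set X) (r : ℝ) (S : Set X) : ℕ∞ :=
  ⨆ (C : Set X) (_ : C ⊆ S) (_ : C.PairwiseDisjoint fun x => B x r), C.encard

/-- `ω_d`, the Lebesgue measure of the unit ball of `ℝᵈ`. -/
def unitBallVolume (d : ℕ) : ℝ≥0∞ :=
  MeasureTheory.volume (Metric.ball (0 : EuclideanSpace ℝ (Fin d)) 1)

end

/-! The centres of a maximal packing by balls of radius `3ε/2` carry a covering of radius `3ε`. If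
`M` has volume at least `ω_d ε^d` in each packing ball, disjointness bounds their number. So the
core is a local volume bound for `ε ≤ τ/4`: orthogonal projection to a tangent space `T` at `x ∈ M`
maps `M ∩ ball x (3ε/2)` onto a set containing a ball of radius `ε`
(`UniqueNearest.ball_subset_image`), and projections do not increase Hausdorff measure.

The reach enters through Federer's inequality `2τ⟪y - z, v⟫ ≤ ‖v‖‖y - z‖²` for `v` normal at `z`
(`UniqueNearest.inner_normal_le`). It holds because a nearest point stays nearest along its normal
segment up to distance `τ` (`UniqueNearest.infDist_extend`), so open balls of radius `τ` touching
`M` there contain no point of `M`.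

For the ball in the image, grow a ball about the projection of `x` until it meets the closure of the
complement of the image. The contact point lifts to `y ∈ M` where the projection is not open, so
some unit `w ∈ T` is normal to `M` at `y`. With `w` turned away from `y`, the boundary point of the
grown ball in direction `w` lifts to `y' ∈ M`, and the pair `y`, `y'` violates Federer's inequality
(`UniqueNearest.false_of_tangent_normal`). -/

open Set Filter Topology Metric

/-! ### Unique nearest points and their continuity. -/

/-- Every point at distance less than `τ` from `S` has a unique nearest point in `S`. -/
def UniqueNearest {X : Type*} [MetricSpace X] (S : Set X) (τ : ℝ) : Prop :=
  ∀ x : X, infDist x S < τ → ∃! y : X, y ∈ S ∧ dist x y = infDist x S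

lemma uniqueNearest_of_le_reach {X : Type*} [MetricSpace X] {S : Set X} {τ : ℝ}
    (hS : S.Nonempty) (h : ENNReal.ofReal τ ≤ reach S) : UniqueNearest S τ := by
  intro x hx
  have htop : infEDist x S ≠ ⊤ := infEDist_ne_top hS
  have hlt : infEDist x S < ENNReal.ofReal τ := by
    rw [← ENNReal.ofReal_toReal htop]
    exact (ENNReal.ofReal_lt_ofReal_iff (lt_of_le_of_lt infDist_nonneg hx)).2 hx
  obtain ⟨r, hr, hxr⟩ := lt_sSup_iff.1 (hlt.trans_le h)
  have key : ∀ y, edist x y = infEDist x S ↔ dist x y = infDist x S := by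
    intro y
    rw [dist_edist, infDist, ENNReal.toReal_eq_toReal_iff' (edist_ne_top _ _) htop]
  simpa only [key] using hr x hxr

namespace UniqueNearest

lemma isClosed {X : Type*} [MetricSpace X] {S : Set X} {τ : ℝ} (h : UniqueNearest S τ)
    (hτ : 0 < τ) : IsClosed S := by
  rcases S.eq_empty_or_nonempty with rfl | hS
  · exact isClosed_empty
  refine isClosed_of_closure_subset fun x hx => ?_
  have h0 : infDist x S = 0 := (mem_closure_iff_infDist_zero hS).1 hx
  obtain ⟨y, ⟨hy, hxy⟩, -⟩ := h x (by rw [h0]; exact hτ)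
  rw [h0, dist_eq_zero] at hxy
  exact hxy ▸ hy

end UniqueNearest

/-- If `z` is the only nearest point of `p`, then the nearest points of the points near `p` are
near `z`. -/
lemma eventually_nearest_dist_lt {X : Type*} [MetricSpace X] [ProperSpace X] {S : Set X}
    (hS : IsClosed S) {p z : X} (huniq : ∀ y ∈ S, dist p y = infDist p S → y = z)
    {η : ℝ} (hη : 0 < η) :
    ∀ᶠ q in 𝓝 p, ∀ y ∈ S, dist q y = infDist q S → dist y z < η := by
  -- On this compact set the distance to `p` exceeds `infDist p S` by a fixed gap, which small moves
  -- of `p` cannot close.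
  set K : Set X := (S ∩ closedBall p (infDist p S + 1)) \ ball z η with hK
  have hKc : IsCompact K :=
    ((isCompact_closedBall _ _).inter_left hS).diff isOpen_ball
  obtain ⟨m, hm, hmK⟩ : ∃ m > infDist p S, ∀ y ∈ K, m ≤ dist p y := by
    rcases K.eq_empty_or_nonempty with h | h
    · exact ⟨infDist p S + 1, by linarith, by simp [h]⟩
    · obtain ⟨y, hy, hmin⟩ := hKc.exists_isMinOn h (f := fun y => dist p y) (by fun_prop)
      refine ⟨dist p y, lt_of_le_of_ne (infDist_le_dist_of_mem hy.1.1) fun heq => hy.2 ?_,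
        fun y' hy' => hmin hy'⟩
      rw [huniq y hy.1.1 heq.symm]
      exact mem_ball_self hη
  have hpos : 0 < min ((m - infDist p S) / 2) (1 / 2) := by
    apply lt_min <;> linarith
  filter_upwards [ball_mem_nhds p hpos] with q hq y hy hqy
  by_contra hyz
  have hq' := lt_min_iff.1 (mem_ball.1 hq)
  have h1 : dist p y ≤ dist q p + infDist q S := by
    rw [← hqy, dist_comm q p]; exact dist_triangle _ _ _
  have h2 : infDist q S ≤ infDist p S + dist q p := infDist_le_infDist_add_dist
  have h3 : y ∈ K := by
    refine ⟨⟨hy, ?_⟩, hyz⟩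
    rw [mem_closedBall, dist_comm]; linarith [hq'.2]
  linarith [hmK y h3, hq'.1]

/-! ### Extending normal segments up to the reach. -/

section InnerProduct

variable {E : Type*} [NormedAddCommGroup E] [InnerProductSpace ℝ E]

local notation "⟪" x ", " y "⟫" => inner ℝ x y

/-- Away from `S`, the distance to `S` grows with speed one when one moves away from a unique nearest
point. -/
lemma exists_infDist_ge_of_unique [FiniteDimensional ℝ E] {S : Set E} (hS : IsClosed S)
    {p z : E} (hz : z ∈ S) (hpz : dist p z = infDist p S) (hp : 0 < infDist p S)
    (huniq : ∀ y ∈ S, dist p y = infDist p S → y = z) {κ : ℝ} (hκ0 : 0 < κ) (hκ : κ < 1)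
    {U : Set E} (hU : U ∈ 𝓝 p) :
    ∃ q ∈ U, q ≠ p ∧ infDist p S + κ * dist q p ≤ infDist q S := by
  set δ := infDist p S with hδ
  have hnorm : ‖p - z‖ = δ := by rw [← dist_eq_norm, hpz]
  have hη : 0 < (1 - κ) * δ := mul_pos (by linarith) hp
  obtain ⟨r, hr, hball⟩ := Metric.mem_nhds_iff.1
    (inter_mem hU (eventually_nearest_dist_lt hS huniq hη))
  set h : ℝ := r / 2 / δ with hh
  have hh0 : 0 < h := by positivity
  set q : E := p + h • (p - z) with hq
  have hqp : dist q p = h * δ := by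
    rw [dist_eq_norm, hq, add_sub_cancel_left, norm_smul, hnorm, Real.norm_of_nonneg hh0.le]
  have hqr : q ∈ ball p r := by
    rw [mem_ball, hqp, hh, div_mul_cancel₀ _ hp.ne']; linarith
  obtain ⟨hqU, hqn⟩ := hball hqr
  refine ⟨q, hqU, fun h' => ?_, ?_⟩
  · rw [h', dist_self] at hqp
    exact (mul_pos hh0 hp).ne hqp
  obtain ⟨y, hy, hqy⟩ := hS.exists_infDist_eq_dist ⟨z, hz⟩ q
  have hyz := hqn y hy hqy.symm
  rw [hqp, hqy]
  have h1 : δ ≤ ‖p - y‖ := by rw [← dist_eq_norm]; exact infDist_le_dist_of_mem hy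
  have h2 : δ ^ 2 - (1 - κ) * δ * δ ≤ ⟪p - y, p - z⟫ := by
    have e : ⟪p - y, p - z⟫ = δ ^ 2 + ⟪z - y, p - z⟫ := by
      rw [← hnorm, ← real_inner_self_eq_norm_sq, ← inner_add_left]; congr 1; abel
    have h3 : |⟪z - y, p - z⟫| ≤ ‖z - y‖ * ‖p - z‖ := abs_real_inner_le_norm _ _
    rw [hnorm, ← dist_eq_norm, dist_comm] at h3
    have h4 := (abs_le.1 h3).1
    nlinarith
  have h5 : dist q y ^ 2 = ‖p - y‖ ^ 2 + 2 * (h * ⟪p - y, p - z⟫) + (h * δ) ^ 2 := by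
    rw [dist_eq_norm, hq, show p + h • (p - z) - y = (p - y) + h • (p - z) by abel,
      norm_add_sq_real, inner_smul_right, norm_smul, hnorm, Real.norm_of_nonneg hh0.le]
  refine le_of_sq_le_sq ?_ dist_nonneg
  rw [h5]
  have h6 : δ ^ 2 ≤ ‖p - y‖ ^ 2 := by gcongr
  have h7 : h * (κ * δ ^ 2) ≤ h * ⟪p - y, p - z⟫ := by
    gcongr; linarith
  have h8 : (κ * (h * δ)) ^ 2 ≤ (h * δ) ^ 2 := by
    have : κ * (h * δ) ≤ h * δ := by nlinarith [mul_pos hh0 hp]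
    gcongr
  nlinarith

/-- Going further along a normal segment, the nearest point stays the same. -/
lemma UniqueNearest.infDist_extend [FiniteDimensional ℝ E] {S : Set E} {τ : ℝ}
    (h : UniqueNearest S τ) {p z : E} (hz : z ∈ S) (hpz : dist p z = infDist p S)
    (hp : 0 < infDist p S) {s : ℝ} (hs : 0 < s) (hsτ : infDist p S + s < τ) :
    infDist (p + (s / infDist p S) • (p - z)) S = infDist p S + s := by
  have hS : IsClosed S := h.isClosed (by linarith)
  set δ := infDist p S with hδ
  have hcomp : IsCompact (closedBall p s) := isCompact_closedBall _ _
  have hne : (closedBall p s).Nonempty := ⟨p, mem_closedBall_self hs.le⟩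
  have hcont : Continuous fun q : E => infDist q S := continuous_infDist_pt S
  have hup : ∀ q ∈ closedBall p s, infDist q S ≤ δ + s := fun q hq =>
    infDist_le_infDist_add_dist.trans (by gcongr; exact hq)
  have step : ∀ κ : ℝ, 0 < κ → κ < 1 → ∃ q ∈ closedBall p s, δ + κ * s ≤ infDist q S := by
    intro κ h0 h1
    -- A maximizer inside the ball could be improved, since the distance to `S` grows there at some
    -- rate `κ' > κ`. So it lies on the sphere, which gives the bound.
    obtain ⟨q, hq, hmax⟩ := hcomp.exists_isMaxOn hne
      (f := fun q => infDist q S - κ * dist q p) (by fun_prop)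
    have hqp : δ ≤ infDist q S - κ * dist q p := by
      simpa using hmax (mem_closedBall_self hs.le)
    have hq0 : 0 < infDist q S := by nlinarith [dist_nonneg (x := q) (y := p)]
    refine ⟨q, hq, ?_⟩
    rcases (mem_closedBall.1 hq).lt_or_eq with hlt | heq
    · exfalso
      obtain ⟨y, ⟨hy, hqy⟩, huniq⟩ := h q ((hup q hq).trans_lt hsτ)
      obtain ⟨κ', hκ1, hκ2⟩ := exists_between h1
      obtain ⟨q', hq', hne', hge⟩ := exists_infDist_ge_of_unique hS hy hqy hq0
        (fun y' hy' hd => huniq y' ⟨hy', hd⟩) (h0.trans hκ1) hκ2 (isOpen_ball.mem_nhds hlt)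
      have h3 : infDist q' S - κ * dist q' p ≤ infDist q S - κ * dist q p :=
        hmax (ball_subset_closedBall hq')
      have h4 : dist q' p ≤ dist q' q + dist q p := dist_triangle _ _ _
      have h5 : 0 < dist q' q := dist_pos.2 hne'
      nlinarith
    · rw [heq] at hqp; linarith
  obtain ⟨q, hq, hmax⟩ := hcomp.exists_isMaxOn hne hcont.continuousOn
  have hge : δ + s ≤ infDist q S := by
    by_contra! hlt
    obtain ⟨κ, hκ1, hκ2⟩ := exists_between
      (max_lt (show (0 : ℝ) < 1 by norm_num)
        (show (infDist q S - δ) / s < 1 by rw [div_lt_one hs]; linarith))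
    obtain ⟨q', hq', hge⟩ := step κ ((le_max_left _ _).trans_lt hκ1) hκ2
    have h1 : infDist q' S ≤ infDist q S := hmax hq'
    have h2 := (le_max_right _ _).trans_lt hκ1
    rw [div_lt_iff₀ hs] at h2
    linarith
  have hnorm : ‖p - z‖ = δ := by rw [← dist_eq_norm, hpz]
  -- Equality in the triangle inequality through `p` forces `q` onto the ray from `z` through `p`.
  have hqz : δ + s ≤ ‖(q - p) + (p - z)‖ := by
    rw [sub_add_sub_cancel, ← dist_eq_norm]; exact hge.trans (infDist_le_dist_of_mem hz)
  have hqp : ‖q - p‖ ≤ s := by rw [← dist_eq_norm]; exact hq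
  have e1 := norm_add_sq_real (q - p) (p - z)
  rw [hnorm] at e1
  have e2 : (δ + s) ^ 2 ≤ ‖(q - p) + (p - z)‖ ^ 2 := by gcongr
  have e3 : ‖q - p‖ ^ 2 ≤ s ^ 2 := by gcongr
  have e4 := norm_sub_sq_real (q - p) ((s / δ) • (p - z))
  rw [inner_smul_right, norm_smul, hnorm, Real.norm_of_nonneg (by positivity),
    div_mul_cancel₀ _ hp.ne'] at e4
  have e5 : s ^ 2 ≤ s / δ * ⟪q - p, p - z⟫ := by
    rw [div_mul_eq_mul_div, le_div_iff₀ hp]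
    nlinarith
  have e6 : ‖(q - p) - (s / δ) • (p - z)‖ = 0 := by
    have : ‖(q - p) - (s / δ) • (p - z)‖ ^ 2 ≤ 0 := by linarith
    exact pow_eq_zero_iff two_ne_zero |>.1 (le_antisymm this (sq_nonneg _))
  have e7 : q = p + (s / δ) • (p - z) := by
    rw [norm_eq_zero, sub_eq_zero] at e6
    rw [← e6]; abel
  rw [← e7]
  exact le_antisymm (hup q hq) hge

/-- The set `S` does not enter the open balls of radius `τ` touching it along a nearest-point
direction. -/
lemma UniqueNearest.inner_nearest_le [FiniteDimensional ℝ E] {S : Set E} {τ : ℝ}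
    (h : UniqueNearest S τ) {p z : E} (hz : z ∈ S) (hpz : dist p z = infDist p S)
    (hpτ : infDist p S < τ) {y : E} (hy : y ∈ S) :
    2 * τ * ⟪y - z, p - z⟫ ≤ ‖p - z‖ * ‖y - z‖ ^ 2 := by
  have hnorm : ‖p - z‖ = infDist p S := by rw [← dist_eq_norm, hpz]
  rcases (infDist_nonneg (x := p) (s := S)).eq_or_lt with h0 | h0
  · rw [← h0] at hnorm
    simp [norm_eq_zero.1 hnorm]
  rw [hnorm]
  set δ := infDist p S with hδ
  have key : ∀ T : ℝ, δ < T → T < τ → 2 * T * ⟪y - z, p - z⟫ ≤ δ * ‖y - z‖ ^ 2 := by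
    intro T hT hTτ
    have hd := h.infDist_extend hz hpz h0 (s := T - δ) (by linarith) (by linarith)
    have h1 : T ≤ ‖(T / δ) • (p - z) - (y - z)‖ := by
      have := infDist_le_dist_of_mem (x := p + ((T - δ) / δ) • (p - z)) hy
      rw [hd, dist_eq_norm] at this
      have e : (T / δ) • (p - z) - (y - z) = p + ((T - δ) / δ) • (p - z) - y := by
        rw [sub_div, div_self h0.ne', sub_smul, one_smul]; abel
      rw [e]
      linarith
    have h2 : T ^ 2 ≤ ‖(T / δ) • (p - z) - (y - z)‖ ^ 2 := by
      have : 0 ≤ T := by linarith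
      gcongr
    rw [norm_sub_sq_real, inner_smul_left, norm_smul, hnorm,
      Real.norm_of_nonneg (div_nonneg (by linarith) h0.le), div_mul_cancel₀ _ h0.ne',
      real_inner_comm] at h2
    have h3 : 2 * (T / δ * ⟪y - z, p - z⟫) ≤ ‖y - z‖ ^ 2 := by
      simp only [conj_trivial] at h2
      linarith
    have h4 := mul_le_mul_of_nonneg_left h3 h0.le
    calc 2 * T * ⟪y - z, p - z⟫ = δ * (2 * (T / δ * ⟪y - z, p - z⟫)) := by field_simp
      _ ≤ _ := h4
  have hlim : Tendsto (fun T : ℝ => 2 * T * ⟪y - z, p - z⟫) (𝓝[<] τ)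
      (𝓝 (2 * τ * ⟪y - z, p - z⟫)) := by
    apply Tendsto.mono_left _ nhdsWithin_le_nhds
    exact Continuous.tendsto (by fun_prop) τ
  refine le_of_tendsto hlim ?_
  filter_upwards [Ioo_mem_nhdsLT hpτ] with T hT using key T hT.1 hT.2

/-! ### Tangent spaces and Federer's inequality. -/

/-- `T` is a tangent space of `M` at `z`: near `z`, the set `M` stays close to `z + T` to first order,
and orthogonal projections to subspaces that are transversal to `Tᗮ` are open on `M` at `z`. -/
structure HasTangentSpaceAt [FiniteDimensional ℝ E] (M : Set E) (T : Submodule ℝ E) (z : E) :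
    Prop where
  eventually_norm_le : ∀ η : ℝ, 0 < η → ∀ᶠ y in 𝓝 z, y ∈ M →
    ‖(y - z) - T.starProjection (y - z)‖ ≤ η * ‖y - z‖
  image_mem_nhds : ∀ W : Submodule ℝ E, W ⊓ Tᗮ = ⊥ → ∀ U ∈ 𝓝 z,
    W.orthogonalProjectionOnto '' (M ∩ U) ∈ 𝓝 (W.orthogonalProjectionOnto z)

/-- A unit normal vector of `M` is a limit of nearest-point directions at nearby points. -/
lemma UniqueNearest.exists_nearest_direction [FiniteDimensional ℝ E] {M : Set E} {τ : ℝ}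
    (h : UniqueNearest M τ) (hτ : 0 < τ) {T : Submodule ℝ E} {z : E} (hz : z ∈ M)
    (hT : HasTangentSpaceAt M T z) {v : E} (hv : v ∈ Tᗮ) (hv1 : ‖v‖ = 1) {η : ℝ} (hη : 0 < η) :
    ∃ z' ∈ M, ∃ u : E, ‖z' - z‖ < η ∧ ‖u - v‖ < η ∧
      ∀ y ∈ M, 2 * τ * ⟪y - z', u⟫ ≤ ‖y - z'‖ ^ 2 := by
  set θ : ℝ := min (η / 8) 1 with hθ
  have hθ0 : 0 < θ := lt_min (by positivity) one_pos
  have hθ1 : θ ≤ 1 := min_le_right _ _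
  have hθη : 8 * θ ≤ η := by linarith [min_le_left (η / 8) 1]
  -- Precision `θ ^ 2` is needed because the tangential shift `a` of the nearest point is controlled
  -- only through `‖a‖ ^ 2`.
  obtain ⟨r, hr, hball⟩ := Metric.eventually_nhds_iff.1
    (hT.eventually_norm_le (θ ^ 2) (by positivity))
  obtain ⟨t, ht0, ht⟩ := exists_between
    (lt_min hτ (lt_min (show 0 < r / 2 by positivity) (show 0 < η / 2 by positivity)))
  obtain ⟨htτ, ht'⟩ := lt_min_iff.1 ht
  obtain ⟨htr, htη⟩ := lt_min_iff.1 ht'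
  set p : E := z + t • v with hp
  have hpz : p - z = t • v := by rw [hp, add_sub_cancel_left]
  have hpzn : ‖p - z‖ = t := by rw [hpz, norm_smul, hv1, mul_one, Real.norm_of_nonneg ht0.le]
  have hpt : infDist p M ≤ t := by
    rw [← hpzn, ← dist_eq_norm]; exact infDist_le_dist_of_mem hz
  obtain ⟨z', ⟨hz', hd⟩, -⟩ := h p (hpt.trans_lt htτ)
  have hn : ‖p - z'‖ ≤ t := by rw [← dist_eq_norm, hd]; exact hpt
  have hg : ‖z' - z‖ ≤ 2 * t := by
    calc ‖z' - z‖ = ‖(p - z) - (p - z')‖ := by congr 1; abel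
      _ ≤ ‖p - z‖ + ‖p - z'‖ := norm_sub_le _ _
      _ ≤ 2 * t := by linarith
  have he := hball (show dist z' z < r by rw [dist_eq_norm]; linarith) hz'
  set a : E := T.starProjection (z' - z) with ha
  have haT : a ∈ T := T.starProjection_apply_mem _
  set e : E := (z' - z) - a with hedef
  have he' : ‖e‖ ≤ 2 * θ ^ 2 * t := by
    refine he.trans ?_
    nlinarith [sq_nonneg θ]
  have hav : ⟪t • v, a⟫ = 0 := by
    rw [inner_smul_left, real_inner_comm, hv a haT, mul_zero]
  have hsplit : p - z' = t • v - a - e := by rw [← hpz, hedef]; abel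
  have hva : ‖t • v - a‖ ≤ t * (1 + 2 * θ ^ 2) := by
    calc ‖t • v - a‖ = ‖(p - z') + e‖ := by rw [hsplit]; congr 1; abel
      _ ≤ ‖p - z'‖ + ‖e‖ := norm_add_le _ _
      _ ≤ _ := by linarith
  have ha3 : ‖a‖ ≤ 3 * θ * t := by
    have h1 := norm_sub_sq_real (t • v) a
    rw [hav, ← hpz, hpzn] at h1
    have h2 : ‖p - z - a‖ ^ 2 ≤ (t * (1 + 2 * θ ^ 2)) ^ 2 := by
      rw [hpz]; gcongr
    refine le_of_sq_le_sq ?_ (by positivity)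
    have h3 : θ ^ 2 ≤ 1 := pow_le_one₀ hθ0.le hθ1
    have h4 : 0 ≤ t ^ 2 * (θ ^ 2 * (1 - θ ^ 2)) :=
      mul_nonneg (sq_nonneg _) (mul_nonneg (sq_nonneg _) (by linarith))
    nlinarith [mul_nonneg (sq_nonneg t) (sq_nonneg θ)]
  refine ⟨z', hz', t⁻¹ • (p - z'), by linarith, ?_, fun y hy => ?_⟩
  · have h1 : t⁻¹ • (p - z') - v = -(t⁻¹ • (a + e)) := by
      rw [hsplit, smul_sub, smul_sub, inv_smul_smul₀ ht0.ne', smul_add]; abel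
    rw [h1, norm_neg, norm_smul, norm_inv, Real.norm_of_nonneg ht0.le, inv_mul_lt_iff₀ ht0]
    have h2 : θ ^ 2 ≤ θ := by nlinarith
    have h3 : ‖a + e‖ ≤ 3 * θ * t + 2 * θ ^ 2 * t := (norm_add_le _ _).trans (by linarith)
    nlinarith [mul_pos hθ0 ht0]
  · have h1 := h.inner_nearest_le hz' hd (hpt.trans_lt htτ) hy
    rw [inner_smul_right]
    have h2 : 2 * τ * ⟪y - z', p - z'⟫ ≤ t * ‖y - z'‖ ^ 2 :=
      h1.trans (by gcongr)
    calc 2 * τ * (t⁻¹ * ⟪y - z', p - z'⟫) = (2 * τ * ⟪y - z', p - z'⟫) / t := by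
          field_simp
      _ ≤ _ := by rw [div_le_iff₀ ht0]; linarith

/-- Federer's inequality for normal vectors of a set with reach at least `τ`. -/
lemma UniqueNearest.inner_normal_le [FiniteDimensional ℝ E] {M : Set E} {τ : ℝ}
    (h : UniqueNearest M τ) (hτ : 0 < τ) {T : Submodule ℝ E} {z : E} (hz : z ∈ M)
    (hT : HasTangentSpaceAt M T z) {v : E} (hv : v ∈ Tᗮ) {y : E} (hy : y ∈ M) :
    2 * τ * ⟪y - z, v⟫ ≤ ‖v‖ * ‖y - z‖ ^ 2 := by
  have unit : ∀ v ∈ Tᗮ, ‖v‖ = 1 → 2 * τ * ⟪y - z, v⟫ ≤ ‖y - z‖ ^ 2 := by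
    intro v hv hv1
    -- The inequality is a closed condition on the pair (foot point, direction), so it passes to
    -- limits of nearest-point directions.
    have hcl : IsClosed {q : E × E | 2 * τ * ⟪y - q.1, q.2⟫ ≤ ‖y - q.1‖ ^ 2} :=
      isClosed_le (by fun_prop) (by fun_prop)
    have hmem : (z, v) ∈ closure {q : E × E | 2 * τ * ⟪y - q.1, q.2⟫ ≤ ‖y - q.1‖ ^ 2} := by
      refine Metric.mem_closure_iff.2 fun η hη => ?_
      obtain ⟨z', -, u, h1, h2, h3⟩ := h.exists_nearest_direction hτ hz hT hv hv1 hη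
      refine ⟨(z', u), h3 y hy, ?_⟩
      rw [dist_comm, Prod.dist_eq, dist_eq_norm, dist_eq_norm]
      exact max_lt h1 h2
    exact hcl.closure_subset hmem
  rcases eq_or_ne v 0 with rfl | hv0
  · simp
  have hn : 0 < ‖v‖ := norm_pos_iff.2 hv0
  have h1 := unit (‖v‖⁻¹ • v) (Submodule.smul_mem _ _ hv)
    (by rw [norm_smul, norm_inv, norm_norm, inv_mul_cancel₀ hn.ne'])
  rw [inner_smul_right] at h1
  calc 2 * τ * ⟪y - z, v⟫ = ‖v‖ * (2 * τ * (‖v‖⁻¹ * ⟪y - z, v⟫)) := by field_simp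
    _ ≤ _ := by gcongr

/-- The distance of a point of `M` to a tangent space of `M` is quadratically small. -/
lemma UniqueNearest.norm_sub_starProjection_le [FiniteDimensional ℝ E] {M : Set E} {τ : ℝ}
    (h : UniqueNearest M τ) (hτ : 0 < τ) {T : Submodule ℝ E} {z : E} (hz : z ∈ M)
    (hT : HasTangentSpaceAt M T z) {y : E} (hy : y ∈ M) :
    2 * τ * ‖(y - z) - T.starProjection (y - z)‖ ≤ ‖y - z‖ ^ 2 := by
  set u := (y - z) - T.starProjection (y - z) with hu
  have huT : u ∈ Tᗮ := T.sub_starProjection_mem_orthogonal _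
  have h1 := h.inner_normal_le hτ hz hT huT hy
  have h2 : ⟪y - z, u⟫ = ‖u‖ ^ 2 := by
    have h3 : ⟪T.starProjection (y - z), u⟫ = 0 := huT _ (T.starProjection_apply_mem _)
    have h4 : y - z = u + T.starProjection (y - z) := by rw [hu]; abel
    rw [← real_inner_self_eq_norm_sq]
    nth_rw 1 [h4]
    rw [inner_add_left, h3, add_zero]
  rw [h2] at h1
  rcases (norm_nonneg u).eq_or_lt with h0 | h0
  · rw [← h0, mul_zero]; positivity
  · nlinarith

/-! ### Projecting `M` onto a tangent space. -/

lemma norm_sq_eq_starProjection_add [FiniteDimensional ℝ E] (T : Submodule ℝ E) (w : E) :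
    ‖w‖ ^ 2 = ‖T.starProjection w‖ ^ 2 + ‖w - T.starProjection w‖ ^ 2 := by
  have h1 : ⟪T.starProjection w, w - T.starProjection w⟫ = 0 :=
    T.sub_starProjection_mem_orthogonal w _ (T.starProjection_apply_mem w)
  have h2 := norm_add_sq_real (T.starProjection w) (w - T.starProjection w)
  rw [h1, add_sub_cancel] at h2
  linarith

/-- The radius `3τ/8` is `3ε/2` at `ε = τ/4`. There the normal part is at most `3/16` of `‖y - z‖`.
The factor `5/4 < (3/2)²` keeps lifts in the open ball of radius `3ε/2`; the factor 2 serves the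
contradiction below. -/
lemma UniqueNearest.norm_sq_le_of_norm_le [FiniteDimensional ℝ E] {M : Set E} {τ : ℝ}
    (h : UniqueNearest M τ) (hτ : 0 < τ) {T : Submodule ℝ E} {z : E} (hz : z ∈ M)
    (hT : HasTangentSpaceAt M T z) {y : E} (hy : y ∈ M) (hyz : 8 * ‖y - z‖ ≤ 3 * τ) :
    ‖y - z‖ ^ 2 ≤ 2 * ‖T.starProjection (y - z)‖ ^ 2 ∧
      4 * ‖y - z‖ ^ 2 ≤ 5 * ‖T.starProjection (y - z)‖ ^ 2 := by
  have h1 := h.norm_sub_starProjection_le hτ hz hT hy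
  have h2 := norm_sq_eq_starProjection_add T (y - z)
  set u := ‖(y - z) - T.starProjection (y - z)‖ with hu
  have hu0 : 0 ≤ u := norm_nonneg _
  have hR0 := norm_nonneg (y - z)
  have h3 : 16 * u ≤ 3 * ‖y - z‖ := by
    have : τ * (16 * u) ≤ τ * (3 * ‖y - z‖) := by nlinarith
    exact le_of_mul_le_mul_left this hτ
  have h4 : (16 * u) ^ 2 ≤ (3 * ‖y - z‖) ^ 2 := by gcongr
  constructor <;> nlinarith [sq_nonneg ‖T.starProjection (y - z)‖]

/-- Two points of `M` near `x`, the first with a normal vector `w` tangent to `M` at `x`, cannot have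
tangential components `a`, `b` with `b = ‖a‖ • w` and `⟪a, w⟫ ≤ 0`. -/
lemma UniqueNearest.false_of_tangent_normal [FiniteDimensional ℝ E] {M : Set E} {τ : ℝ}
    (h : UniqueNearest M τ) (hτ : 0 < τ) {T T' : Submodule ℝ E} {x y y' w : E} (hx : x ∈ M)
    (hT : HasTangentSpaceAt M T x) (hy : y ∈ M) (hT' : HasTangentSpaceAt M T' y) (hy' : y' ∈ M)
    (hyx : 8 * ‖y - x‖ ≤ 3 * τ) (hyx' : 8 * ‖y' - x‖ ≤ 3 * τ)
    (hw : w ∈ T) (hw' : w ∈ T'ᗮ) (hw1 : ‖w‖ = 1)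
    (ha : 4 * ‖T.starProjection (y - x)‖ ≤ τ) (ha0 : 0 < ‖T.starProjection (y - x)‖)
    (haw : ⟪T.starProjection (y - x), w⟫ ≤ 0)
    (hb : T.starProjection (y' - x) = ‖T.starProjection (y - x)‖ • w) : False := by
  have hu := h.norm_sub_starProjection_le hτ hx hT hy
  have hu' := h.norm_sub_starProjection_le hτ hx hT hy'
  have hR := (h.norm_sq_le_of_norm_le hτ hx hT hy hyx).1
  have hR' := (h.norm_sq_le_of_norm_le hτ hx hT hy' hyx').1
  have hN := h.inner_normal_le hτ hy hT' hw' hy'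
  have hP := norm_sq_eq_starProjection_add T (y' - y)
  have hproj : T.starProjection (y' - y) = T.starProjection (y' - x) - T.starProjection (y - x) := by
    rw [← map_sub]; congr 1; abel
  have hres : (y' - y) - T.starProjection (y' - y) =
      ((y' - x) - T.starProjection (y' - x)) - ((y - x) - T.starProjection (y - x)) := by
    rw [hproj]; abel
  have hresn : ‖(y' - y) - T.starProjection (y' - y)‖ ≤
      ‖(y' - x) - T.starProjection (y' - x)‖ + ‖(y - x) - T.starProjection (y - x)‖ := by
    rw [hres]; exact norm_sub_le _ _
  have hin : ⟪y' - y, w⟫ = ⟪T.starProjection (y' - y), w⟫ := by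
    have h1 : ⟪w, (y' - y) - T.starProjection (y' - y)⟫ = 0 :=
      T.sub_starProjection_mem_orthogonal (y' - y) w hw
    rw [inner_sub_right, sub_eq_zero] at h1
    rw [real_inner_comm, h1, real_inner_comm]
  set a := T.starProjection (y - x) with hadef
  set l := ‖a‖ with hl
  rw [hproj, hb] at hin hP
  rw [hb, norm_smul, hw1, norm_norm, mul_one] at hR'
  rw [inner_sub_left (l • w), inner_smul_left, real_inner_self_eq_norm_sq, hw1] at hin
  simp only [conj_trivial, one_pow, mul_one] at hin
  have hab := norm_sub_sq_real (l • w) a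
  rw [norm_smul, hw1, norm_norm, inner_smul_left, real_inner_comm] at hab
  simp only [conj_trivial, mul_one] at hab
  rw [hproj, hb] at hresn
  rw [hb] at hu'
  rw [← hl] at hab hR'
  set c := ⟪a, w⟫ with hc
  set r := ‖y' - y - (l • w - a)‖ with hr
  have hr0 : 0 ≤ r := norm_nonneg _
  have hrτ : τ * r ≤ 2 * l ^ 2 := by nlinarith
  have hrl : 2 * r ≤ l := by
    have : τ * (2 * r) ≤ τ * l := by nlinarith
    exact le_of_mul_le_mul_left this hτ
  rw [hin, hw1, one_mul, hP, hab] at hN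
  -- As `r ≤ l/2`, the right side is at most `9l²/4 - 2lc`, while `τ ≥ 4l` makes the left side at
  -- least `8l² - 8lc`; here `c ≤ 0 < l`.
  nlinarith

lemma exists_norm_eq_one_of_ne_bot {E : Type*} [NormedAddCommGroup E] [NormedSpace ℝ E]
    {W : Submodule ℝ E} (hW : W ≠ ⊥) : ∃ w ∈ W, ‖w‖ = 1 := by
  obtain ⟨v, hv, hv0⟩ := W.ne_bot_iff.1 hW
  refine ⟨‖v‖⁻¹ • v, W.smul_mem _ hv, ?_⟩
  rw [norm_smul, norm_inv, norm_norm, inv_mul_cancel₀ (norm_ne_zero_iff.2 hv0)]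

/-- The orthogonal projection to the tangent space at `x` maps the part of `M` near `x` onto a ball
of comparable radius. -/
lemma UniqueNearest.ball_subset_image [FiniteDimensional ℝ E] {M : Set E} {τ : ℝ}
    (h : UniqueNearest M τ) (hτ : 0 < τ)
    (htan : ∀ y ∈ M, ∃ T' : Submodule ℝ E, HasTangentSpaceAt M T' y)
    {T : Submodule ℝ E} {x : E} (hx : x ∈ M) (hT : HasTangentSpaceAt M T x)
    {ε : ℝ} (hε : 0 < ε) (hετ : ε ≤ τ / 4) :
    ball (T.orthogonalProjectionOnto x) ε ⊆
      T.orthogonalProjectionOnto '' (M ∩ ball x (3 * ε / 2)) := by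
  set π := T.orthogonalProjectionOnto with hπ
  have hcoe : ∀ y, ((π y - π x : T) : E) = T.starProjection (y - x) := by
    intro y; rw [← map_sub]; rfl
  have hdist : ∀ y, dist (π y) (π x) = ‖T.starProjection (y - x)‖ := by
    intro y; rw [← hcoe, dist_eq_norm, Submodule.coe_norm]
  set K : Set T := π '' (M ∩ closedBall x (3 * ε / 2)) with hK
  have hKc : IsClosed K :=
    (((isCompact_closedBall x _).inter_left (h.isClosed hτ)).image π.continuous).isClosed
  have hnear : ∀ y ∈ M ∩ closedBall x (3 * ε / 2), 8 * ‖y - x‖ ≤ 3 * τ := by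
    rintro y ⟨-, hy⟩
    rw [mem_closedBall, dist_eq_norm] at hy
    linarith
  have hstrict : ∀ y ∈ M ∩ closedBall x (3 * ε / 2), dist (π y) (π x) < ε →
      y ∈ ball x (3 * ε / 2) := by
    intro y hy hyε
    rw [hdist] at hyε
    have h1 := (h.norm_sq_le_of_norm_le hτ hx hT hy.1 (hnear y hy)).2
    rw [mem_ball, dist_eq_norm]
    have h2 : ‖T.starProjection (y - x)‖ ^ 2 ≤ ε ^ 2 := by gcongr
    refine lt_of_pow_lt_pow_left₀ 2 (by positivity) ?_
    nlinarith
  suffices hsub : ball (π x) ε ⊆ K by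
    intro q hq
    obtain ⟨y, hy, rfl⟩ := hsub hq
    exact ⟨y, ⟨hy.1, hstrict y hy hq⟩, rfl⟩
  by_contra hns
  obtain ⟨q, hq, hqK⟩ := Set.not_subset.1 hns
  set l := infDist (π x) Kᶜ with hl
  have hlε : l < ε := by
    refine (infDist_le_dist_of_mem (s := Kᶜ) hqK).trans_lt ?_
    rw [dist_comm]; exact hq
  obtain ⟨a, hacl, hla⟩ := isClosed_closure.exists_infDist_eq_dist
    (show (closure Kᶜ).Nonempty from ⟨q, subset_closure hqK⟩) (π x)
  rw [infDist_closure, dist_comm, ← hl] at hla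
  have hball : closedBall (π x) l ⊆ K := by
    have hxK : π x ∈ K := ⟨x, ⟨hx, mem_closedBall_self (by positivity)⟩, rfl⟩
    rcases (infDist_nonneg (x := π x) (s := Kᶜ)).eq_or_lt with h0 | h0
    · rw [hl, ← h0, closedBall_zero]
      exact Set.singleton_subset_iff.2 hxK
    · rw [← closure_ball _ h0.ne']
      refine closure_minimal ?_ hKc
      exact Set.disjoint_compl_right_iff_subset.1 disjoint_ball_infDist
  obtain ⟨y, hy, rfl⟩ := hball (mem_closedBall.2 hla.ge)
  have hyn := hnear y hy
  have hy' := hstrict y hy (hla ▸ hlε)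
  -- When `l = 0` the contact point lifts to `x` itself; choosing `T' = T` then rules out the
  -- degenerate case.
  obtain ⟨T', hT', hT0⟩ : ∃ T' : Submodule ℝ E, HasTangentSpaceAt M T' y ∧
      (l = 0 → T ⊓ T'ᗮ = ⊥) := by
    by_cases h0 : l = 0
    · have h1 := (h.norm_sq_le_of_norm_le hτ hx hT hy.1 hyn).2
      rw [← hdist, ← hla, h0] at h1
      have h2 : ‖y - x‖ = 0 := by
        have : ‖y - x‖ ^ 2 ≤ 0 := by linarith
        exact pow_eq_zero_iff two_ne_zero |>.1 (le_antisymm this (sq_nonneg _))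
      rw [norm_eq_zero, sub_eq_zero] at h2
      exact ⟨T, h2 ▸ hT, fun _ => T.inf_orthogonal_eq_bot⟩
    · obtain ⟨T', hT'⟩ := htan y hy.1
      exact ⟨T', hT', fun h' => absurd h' h0⟩
  by_cases hbot : T ⊓ T'ᗮ = ⊥
  · obtain ⟨b, hb1, hb2⟩ := mem_closure_iff_nhds.1 hacl _
      (hT'.image_mem_nhds T hbot _ (isOpen_ball.mem_nhds hy'))
    exact hb2 (Set.image_mono (Set.inter_subset_inter_right _ ball_subset_closedBall) hb1)
  have hl0 : 0 < l := lt_of_le_of_ne infDist_nonneg fun h0 => hbot (hT0 h0.symm)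
  obtain ⟨w, ⟨hwT, hwT'⟩, hw1, haw⟩ : ∃ w ∈ T ⊓ T'ᗮ, ‖w‖ = 1 ∧
      ⟪T.starProjection (y - x), w⟫ ≤ 0 := by
    obtain ⟨w, hw, hw1⟩ := exists_norm_eq_one_of_ne_bot hbot
    rcases le_total ⟪T.starProjection (y - x), w⟫ 0 with h0 | h0
    · exact ⟨w, hw, hw1, h0⟩
    · exact ⟨-w, neg_mem hw, by rwa [norm_neg], by rw [inner_neg_right]; linarith⟩
  have hmem : π x + l • (⟨w, hwT⟩ : T) ∈ closedBall (π x) l := by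
    rw [mem_closedBall, dist_eq_norm, add_sub_cancel_left, norm_smul,
      show ‖(⟨w, hwT⟩ : T)‖ = 1 from hw1, mul_one, Real.norm_of_nonneg hl0.le]
  obtain ⟨y', hyK', hyb⟩ := hball hmem
  have hb : T.starProjection (y' - x) = l • w := by
    rw [← hcoe, hyb, add_sub_cancel_left]; rfl
  have hla' := hla.trans (hdist y)
  refine h.false_of_tangent_normal hτ hx hT hy.1 hT' hyK'.1 hyn (hnear y' hyK') hwT hwT' hw1
    ?_ ?_ haw ?_
  · linarith
  · linarith
  · rw [hb, hla']

end InnerProduct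

/-! ### Tangent spaces of `C¹` submanifolds. -/

/-- The points of a `C¹` submanifold have tangent spaces of the right dimension. -/
lemma IsC1Submanifold.exists_hasTangentSpaceAt {n d : ℕ} {M : Set (EuclideanSpace ℝ (Fin n))}
    (hM : IsC1Submanifold d M) {z : EuclideanSpace ℝ (Fin n)} (hz : z ∈ M) :
    ∃ T : Submodule ℝ (EuclideanSpace ℝ (Fin n)),
      Module.finrank ℝ T = d ∧ HasTangentSpaceAt M T z := by
  obtain ⟨Φ, L, hzs, hΦ, hΨ, hL, him⟩ := hM z hz
  have hzt : Φ z ∈ Φ.target := Φ.map_source hzs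
  have hzL : Φ z ∈ L := (him.apply_mem_iff hzs).2 hz
  have dΦ := (hΦ.contDiffAt (Φ.open_source.mem_nhds hzs)).hasStrictFDerivAt one_ne_zero
  have dΨ := (hΨ.contDiffAt (Φ.open_target.mem_nhds hzt)).hasStrictFDerivAt one_ne_zero
  set A := fderiv ℝ Φ.symm (Φ z) with hA
  set A' := fderiv ℝ Φ z with hA'
  have hinv : ∀ v, A' (A v) = v := by
    have h1 : HasFDerivAt (Φ ∘ Φ.symm) (A'.comp A) (Φ z) := by
      refine HasFDerivAt.comp (Φ z) ?_ dΨ.hasFDerivAt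
      rw [Φ.left_inv hzs]; exact dΦ.hasFDerivAt
    have h2 : HasFDerivAt (Φ ∘ Φ.symm) (ContinuousLinearMap.id ℝ _) (Φ z) := by
      refine (hasFDerivAt_id (Φ z)).congr_of_eventuallyEq ?_
      filter_upwards [Φ.open_target.mem_nhds hzt] with y hy using Φ.right_inv hy
    intro v
    exact DFunLike.congr_fun (h1.unique h2) v
  have hinj : Function.Injective A := Function.LeftInverse.injective hinv
  refine ⟨L.map A.toLinearMap, ?_, ?_, ?_⟩
  · rw [← hL]
    exact (LinearEquiv.finrank_eq (Submodule.equivMapOfInjective A.toLinearMap hinj L)).symm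
  · intro η hη
    obtain ⟨C, hC0, hC⟩ := dΦ.hasFDerivAt.isBigO_sub.exists_pos
    have hlo := dΨ.hasFDerivAt.isLittleO.def (show 0 < η / C by positivity)
    filter_upwards [hC.bound, (Φ.continuousAt hzs).eventually hlo, Φ.open_source.mem_nhds hzs]
      with y hy1 hy2 hys hyM
    rw [Φ.left_inv hys, Φ.left_inv hzs] at hy2
    have hyL : Φ y ∈ L := (him.apply_mem_iff hys).2 hyM
    have hmem : A (Φ y - Φ z) ∈ L.map A.toLinearMap :=
      Submodule.mem_map_of_mem (L.sub_mem hyL hzL)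
    calc _ ≤ ‖(y - z) - A (Φ y - Φ z)‖ := by
          rw [Submodule.starProjection_minimal]
          exact ciInf_le ⟨0, by rintro _ ⟨w, rfl⟩; exact norm_nonneg _⟩ (⟨_, hmem⟩ : L.map A.toLinearMap)
      _ ≤ η / C * ‖Φ y - Φ z‖ := hy2
      _ ≤ η / C * (C * ‖y - z‖) := by gcongr
      _ = η * ‖y - z‖ := by field_simp
  · intro W hW U hU
    set z' : L := ⟨Φ z, hzL⟩ with hz'
    have d1 : HasStrictFDerivAt (fun l : L => W.orthogonalProjectionOnto (Φ.symm l))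
        ((W.orthogonalProjectionOnto.comp A).comp L.subtypeL) z' := by
      refine HasStrictFDerivAt.comp z' (g := W.orthogonalProjectionOnto ∘ Φ.symm) ?_
        L.subtypeL.hasStrictFDerivAt
      exact W.orthogonalProjectionOnto.hasStrictFDerivAt.comp _ dΨ
    -- The orthogonal complement of this range in `W` is `W ⊓ Tᗮ`. Surjectivity of the strict
    -- derivative then gives openness.
    have hsurj : ((W.orthogonalProjectionOnto.comp A).comp L.subtypeL).range = ⊤ := by
      rw [← Submodule.orthogonal_eq_bot_iff, Submodule.eq_bot_iff]
      rintro ⟨w, hw⟩ hwr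
      have : w ∈ W ⊓ (L.map A.toLinearMap)ᗮ := by
        refine ⟨hw, ?_⟩
        rintro _ ⟨l, hl, rfl⟩
        have := hwr _ ⟨(⟨l, hl⟩ : L), rfl⟩
        simpa using this
      rw [hW, Submodule.mem_bot] at this
      exact Subtype.ext this
    have hmap := d1.map_nhds_eq_of_surj hsurj
    have hcont : ContinuousAt (fun l : L => Φ.symm l) z' :=
      ContinuousAt.comp (x := z') (f := fun l : L => (l : EuclideanSpace ℝ (Fin n)))
        (g := Φ.symm) (Φ.continuousAt_symm hzt) continuous_subtype_val.continuousAt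
    have hV : {l : L | Φ.symm l ∈ U ∧ (l : EuclideanSpace ℝ (Fin n)) ∈ Φ.target} ∈ 𝓝 z' := by
      refine inter_mem (hcont ?_) (continuous_subtype_val.continuousAt (Φ.open_target.mem_nhds hzt))
      simpa only [hz', Φ.left_inv hzs] using hU
    have himg := image_mem_map (m := fun l : L => W.orthogonalProjectionOnto (Φ.symm l)) hV
    rw [hmap] at himg
    simp only [hz', Φ.left_inv hzs] at himg
    refine mem_of_superset himg ?_
    rintro _ ⟨l, ⟨hlU, hlt⟩, rfl⟩
    exact ⟨_, ⟨(him.symm_apply_mem_iff hlt).2 l.2, hlU⟩, rfl⟩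

/-! ### Covering, packing and measure. -/

lemma coveringNum_le_packingNum {X : Type*} [MetricSpace X] {B : X → ℝ → Set X}
    (hB : B = ball ∨ B = closedBall) {r : ℝ} (hr : 0 < r) (S : Set X) :
    coveringNum B (2 * r) S ≤ packingNum B r S := by
  obtain ⟨C, hC⟩ := zorn_subset {C : Set X | C ⊆ S ∧ C.PairwiseDisjoint fun x => B x r} (by
    intro c hc hchain
    refine ⟨⋃₀ c, ⟨sUnion_subset fun s hs => (hc hs).1, ?_⟩, fun s hs => subset_sUnion_of_mem hs⟩
    exact (pairwiseDisjoint_sUnion hchain.directedOn).2 fun s hs => (hc hs).2)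
  have hmeet : ∀ x c : X, ¬ Disjoint (B c r) (B x r) → x ∈ B c (2 * r) := by
    intro x c hd
    obtain ⟨y, hy1, hy2⟩ := Set.not_disjoint_iff.1 hd
    rcases hB with rfl | rfl
    · rw [mem_ball] at *
      linarith [dist_triangle_left x c y]
    · rw [mem_closedBall] at *
      linarith [dist_triangle_left x c y]
  have hself : ∀ x : X, ∀ s : ℝ, 0 < s → x ∈ B x s := by
    intro x s hs
    rcases hB with rfl | rfl
    · exact mem_ball_self hs
    · exact mem_closedBall_self hs.le
  have hcov : S ⊆ ⋃ p ∈ (fun c => (c, 2 * r)) '' C, B p.1 p.2 := by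
    intro x hx
    suffices ∃ c ∈ C, x ∈ B c (2 * r) by simpa using this
    by_contra! hno
    have hxC : x ∉ C := fun h => hno x h (hself x _ (by linarith))
    have hins : insert x C ∈ {C : Set X | C ⊆ S ∧ C.PairwiseDisjoint fun x => B x r} := by
      refine ⟨insert_subset hx hC.prop.1, hC.prop.2.insert fun c hc _ => ?_⟩
      by_contra hd
      exact hno c hc (hmeet x c fun h => hd h.symm)
    exact hxC (hC.le_of_ge hins (subset_insert x C) (mem_insert x C))
  calc coveringNum B (2 * r) S ≤ ((fun c => (c, 2 * r)) '' C).encard :=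
        iInf_le_of_le _ (iInf_le_of_le (by rintro _ ⟨c, -, rfl⟩; exact le_rfl)
          (iInf_le_of_le hcov le_rfl))
    _ ≤ C.encard := encard_image_le _ _
    _ ≤ packingNum B r S :=
        le_iSup_of_le C (le_iSup_of_le hC.prop.1 (le_iSup_of_le hC.prop.2 le_rfl))

lemma coveringNum_anti {X : Type*} (B : X → ℝ → Set X) (S : Set X) {r s : ℝ} (h : r ≤ s) :
    coveringNum B s S ≤ coveringNum B r S :=
  le_iInf fun F => le_iInf fun hF => le_iInf fun hS =>
    iInf_le_of_le F (iInf_le_of_le (fun p hp => (hF p hp).trans h) (iInf_le_of_le hS le_rfl))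

open MeasureTheory in
lemma packingNum_mul_le {X : Type*} [MetricSpace X] [MeasurableSpace X]
    [OpensMeasurableSpace X] {B : X → ℝ → Set X} (hB : B = ball ∨ B = closedBall) (μ : Measure X)
    {S : Set X} (hS : MeasurableSet S) {r : ℝ} {m : ℝ≥0∞}
    (hm : ∀ x ∈ S, m ≤ μ (S ∩ B x r)) :
    (packingNum B r S : ℝ≥0∞) * m ≤ μ S := by
  have hBm : ∀ x, MeasurableSet (B x r) := by
    rcases hB with rfl | rfl
    · exact fun x => measurableSet_ball
    · exact fun x => measurableSet_closedBall
  simp only [packingNum, ENat.toENNReal_iSup, ENNReal.iSup_mul]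
  refine iSup_le fun C => iSup_le fun hCS => iSup_le fun hC => ?_
  calc (C.encard : ℝ≥0∞) * m = ∑' _ : C, m := by
        rw [ENNReal.tsum_const]; rfl
    _ ≤ ∑' c : C, μ (S ∩ B c r) := ENNReal.tsum_le_tsum fun c => hm c (hCS c.2)
    _ ≤ μ (⋃ c : C, S ∩ B c r) := by
        refine tsum_meas_le_meas_iUnion_of_disjoint μ (fun c => hS.inter (hBm c)) ?_
        intro c c' hcc
        exact (hC c.2 c'.2 (Subtype.coe_ne_coe.2 hcc)).mono inter_subset_right inter_subset_right
    _ ≤ μ S := measure_mono (iUnion_subset fun c => inter_subset_left)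

/-! ### The local volume bound and the conclusion. -/

open MeasureTheory in
lemma LipschitzWith.euclideanHausdorffMeasure_image_le {X Y : Type*} [MetricSpace X]
    [MeasurableSpace X] [BorelSpace X] [MetricSpace Y] [MeasurableSpace Y] [BorelSpace Y]
    {f : X → Y} (hf : LipschitzWith 1 f) (d : ℕ) (s : Set X) :
    μHE[d] (f '' s) ≤ μHE[d] s := by
  simp only [Measure.euclideanHausdorffMeasure_def, Measure.smul_apply]
  have := hf.hausdorffMeasure_image_le (d := (d : ℝ)) (by positivity) s
  simp only [ENNReal.coe_one, ENNReal.one_rpow, one_mul] at this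
  gcongr

open MeasureTheory in
lemma volume_ball_eq_unitBallVolume {F : Type*} [NormedAddCommGroup F] [InnerProductSpace ℝ F]
    [FiniteDimensional ℝ F] [MeasurableSpace F] [BorelSpace F] {d : ℕ}
    (hd : Module.finrank ℝ F = d) (x : F) {ε : ℝ} (hε : 0 < ε) :
    volume (ball x ε) = unitBallVolume d * ENNReal.ofReal ε ^ d := by
  subst hd
  rw [Measure.addHaar_ball_of_pos _ _ hε, ENNReal.ofReal_pow hε.le, mul_comm, unitBallVolume,
    ← (stdOrthonormalBasis ℝ F).measurePreserving_repr.measure_preimage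
      measurableSet_ball.nullMeasurableSet, LinearIsometryEquiv.preimage_ball, map_zero]

open MeasureTheory in
lemma UniqueNearest.unitBallVolume_mul_le {n d : ℕ} {M : Set (EuclideanSpace ℝ (Fin n))}
    (hM : IsC1Submanifold d M) {τ : ℝ} (h : UniqueNearest M τ) (hτ : 0 < τ)
    {x : EuclideanSpace ℝ (Fin n)} (hx : x ∈ M) {ε : ℝ} (hε : 0 < ε) (hετ : ε ≤ τ / 4) :
    unitBallVolume d * ENNReal.ofReal ε ^ d ≤ μHE[d] (M ∩ ball x (3 * ε / 2)) := by
  obtain ⟨T, hd, hT⟩ := hM.exists_hasTangentSpaceAt hx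
  have hsub := h.ball_subset_image hτ
    (fun y hy => (hM.exists_hasTangentSpaceAt hy).imp fun _ h' => h'.2) hx hT hε hετ
  have hlip : LipschitzWith 1 T.orthogonalProjectionOnto := by
    refine T.orthogonalProjectionOnto.lipschitz.weaken ?_
    exact_mod_cast T.orthogonalProjectionOnto_norm_le
  calc unitBallVolume d * ENNReal.ofReal ε ^ d
      = μHE[d] (ball (T.orthogonalProjectionOnto x) ε) := by
        rw [← volume_ball_eq_unitBallVolume hd _ hε, ← hd,
          InnerProductSpace.euclideanHausdorffMeasure_eq_volume]
    _ ≤ μHE[d] (T.orthogonalProjectionOnto '' (M ∩ ball x (3 * ε / 2))) := measure_mono hsub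
    _ ≤ _ := hlip.euclideanHausdorffMeasure_image_le d _

lemma packingNum_le_of_le_reach {n d : ℕ} {M : Set (EuclideanSpace ℝ (Fin n))}
    (hM : IsC1Submanifold d M) {τ : ℝ} (hτ : 0 < τ) (hreach : ENNReal.ofReal τ ≤ reach M)
    {ε : ℝ} (hε : 0 < ε) (hετ : ε ≤ τ / 4)
    {B : EuclideanSpace ℝ (Fin n) → ℝ → Set (EuclideanSpace ℝ (Fin n))}
    (hB : B = ball ∨ B = closedBall) :
    (packingNum B (3 * ε / 2) M : ℝ≥0∞) ≤
      μHE[d] M / (unitBallVolume d * ENNReal.ofReal ε ^ d) := by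
  -- The real-valued `infDist` to the empty set is 0, so `UniqueNearest` fails for `∅` although its
  -- reach is infinite.
  rcases M.eq_empty_or_nonempty with rfl | hne
  · have : packingNum B (3 * ε / 2) ∅ = 0 := by
      simp only [packingNum, ENat.iSup_eq_zero]
      intro C hC _
      rw [subset_empty_iff.1 hC, encard_empty]
    simp [this]
  have h := uniqueNearest_of_le_reach hne hreach
  have hpos : unitBallVolume d * ENNReal.ofReal ε ^ d ≠ 0 := by
    refine mul_ne_zero (Metric.measure_ball_pos _ _ one_pos).ne' (pow_ne_zero _ ?_)
    simpa using hε
  have htop : unitBallVolume d * ENNReal.ofReal ε ^ d ≠ ⊤ :=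
    ENNReal.mul_ne_top MeasureTheory.measure_ball_lt_top.ne (ENNReal.pow_ne_top ENNReal.ofReal_ne_top)
  rw [ENNReal.le_div_iff_mul_le (Or.inl hpos) (Or.inl htop)]
  refine packingNum_mul_le hB _ (h.isClosed hτ).measurableSet fun x hx => ?_
  refine (h.unitBallVolume_mul_le hM hτ hx hε hετ).trans (MeasureTheory.measure_mono ?_)
  rcases hB with rfl | rfl
  · exact subset_rfl
  · exact inter_subset_inter_right _ ball_subset_closedBall

theorem mainTheorem9 (n d : ℕ) (M : Set (EuclideanSpace ℝ (Fin n)))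
    (hM : IsC1Submanifold d M)
    (τ : ℝ) (hτ : 0 < τ) (hreach : ENNReal.ofReal τ ≤ reach M)
    (V : ℝ≥0) (hV : μHE[d] M ≤ (V : ℝ≥0∞))
    (ε : ℝ) (hε : 0 < ε)
    (B : EuclideanSpace ℝ (Fin n) → ℝ → Set (EuclideanSpace ℝ (Fin n)))
    (hB : B = Metric.ball ∨ B = Metric.closedBall) :
    (ε ≤ τ / 4 →
      coveringNum B (3 * ε) M ≤ packingNum B (3 * ε / 2) M ∧
      (packingNum B (3 * ε / 2) M : ℝ≥0∞) ≤
        (V : ℝ≥0∞) / (unitBallVolume d * ENNReal.ofReal ε ^ d)) ∧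
    (τ / 4 < ε →
      (coveringNum B (3 * ε) M : ℝ≥0∞) ≤
        (V : ℝ≥0∞) / (unitBallVolume d * ENNReal.ofReal (τ / 4) ^ d)) := by

  have hcp : ∀ δ : ℝ, 0 < δ → coveringNum B (3 * δ) M ≤ packingNum B (3 * δ / 2) M := by
    intro δ hδ
    have := coveringNum_le_packingNum hB (show 0 < 3 * δ / 2 by positivity) M
    rwa [mul_div_cancel₀ _ (two_ne_zero' ℝ)] at this
  have hpack : ∀ δ : ℝ, 0 < δ → δ ≤ τ / 4 → (packingNum B (3 * δ / 2) M : ℝ≥0∞) ≤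
      (V : ℝ≥0∞) / (unitBallVolume d * ENNReal.ofReal δ ^ d) := fun δ hδ hδτ =>
    (packingNum_le_of_le_reach hM hτ hreach hδ hδτ hB).trans (by gcongr)
  refine ⟨fun h => ⟨hcp ε hε, hpack ε hε h⟩, fun h => ?_⟩
  have hτ4 : 0 < τ / 4 := by positivity
  -- Covering numbers decrease in the radius, so the bound at `τ/4` serves every larger `ε`.
  refine le_trans ?_ (hpack (τ / 4) hτ4 le_rfl)
  exact ENat.toENNReal_le.2 ((coveringNum_anti B M (by linarith)).trans (hcp _ hτ4))
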